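/- Let $n$ be a positive integer. For $m\ge 0$, let $\mathcal{R}_{n,n,n:m}$ be the set of partial Latin squares of order $n$ with exactly $m$ entries, that is, of $n\times n$ arrays in which each cell is either empty or contains one symbol of $\{1,\ldots,n\}$, each symbol occurs at most once in each row and at most once in each column, and exactly $m$ cells are non-empty. Then \begin{enumerate} \item[a)] $|\mathcal{R}_{n,n,n:0}|=1$. \item[b)] $|\mathcal{R}_{n,n,n:1}|=n^3$. \item[c)] $2!\,|\mathcal{R}_{n,n,n:2}|=n^3(n-1)^2(n+2)$. \item[d)] $3!\,|\mathcal{R}_{n,n,n:3}|=n^3(n-1)^2(n^4+2n^3-6n^2-8n+14)$. \item[e)] $4!\,|\mathcal{R}_{n,n,n:4}|=n^3(n-1)^2(n^7+2n^6-15n^5-20n^4+98n^3+36n^2-288n+198)$. \item[f)] $5!\,|\mathcal{R}_{n,n,n:5}|=n^3(n-1)^2(n-2)^2(n^8+6n^7-7n^6-88n^5+6n^4+532n^3-84n^2-1386n+1128)$. \item[g)] $6!\,|\mathcal{R}_{n,n,n:6}|=n^3(n-1)^2(n-2)^2(n^{11}+6n^{10}-22n^9-168n^8+231n^7+2022n^6-2014n^5-12606n^4+16168n^3+32250n^2-70740n+36600)$.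 \end{enumerate} -/

import Mathlib

/-- An `r × s` array, each of whose cells is either empty (`none`) or contains one symbol of an
`n`-element set, is a partial Latin rectangle if each symbol occurs at most once in each row and
at most once in each column. -/
def IsPartialLatinRectangle {r s n : ℕ} (P : Fin r → Fin s → Option (Fin n)) : Prop :=
  (∀ (i : Fin r) (j j' : Fin s) (k : Fin n), P i j = some k → P i j' = some k → j = j') ∧
  (∀ (i i' : Fin r) (j : Fin s) (k : Fin n), P i j = some k → P i' j = some k → i = i')

/-- The size of an array: the number of its non-empty cells. -/
def arraySize {r s n : ℕ} (P : Fin r → Fin s → Option (Fin n)) : ℕ :=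
  (Finset.univ.filter fun c : Fin r × Fin s => (P c.1 c.2).isSome = true).card

/-- The set of `r × s` partial Latin rectangles based on `n` symbols. -/
def partialLatinRectangles (r s n : ℕ) : Set (Fin r → Fin s → Option (Fin n)) :=
  {P | IsPartialLatinRectangle P}

/-- The set of `r × s` partial Latin rectangles based on `n` symbols that have size `m`. -/
def partialLatinRectanglesOfSize (r s n m : ℕ) : Set (Fin r → Fin s → Option (Fin n)) :=
  {P | P ∈ partialLatinRectangles r s n ∧ arraySize P = m}

/-! A partial Latin square is a set of entries (row, column, symbol), no two of which agree in two
coordinates. Ordering its `m` entries contributes the factor `m!`. An ordered tuple of entries is a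
triple of functions on `{0, …, m - 1}`, and admissibility depends only on their three fibre
partitions: no two distinct indices may share a block in two of them. A partition with `a` blocks is
the fibre partition of exactly `n (n - 1) ⋯ (n - a + 1)` functions into `Fin n`. Hence `m!` times
the count is the sum of `N(a, b, c) (n)_a (n)_b (n)_c`, where `N` counts triples of partitions with
pairwise trivial meets and the given block numbers
(`factorial_mul_ncard_partialLatinRectanglesOfSize`).

The numbers `N` do not depend on `n`, so for each `m ≤ 6` they form a finite table. To verify it, a
partition becomes a bit mask of its pairs, trivial meet becomes disjointness of masks, and a whole
list of masks is tested at once inside one large natural number (`packedCount_eq`). Symmetry reduces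
the check to `a ≤ b ≤ c`. Expanding the falling factorials then gives each polynomial. -/

/-- Two entries (row, column, symbol) agree in at least two of their three coordinates. -/
def AgreeTwice {A B C : Type*} (u v : A × B × C) : Prop :=
  (u.1 = v.1 ∧ u.2.1 = v.2.1) ∨ (u.1 = v.1 ∧ u.2.2 = v.2.2) ∨ (u.2.1 = v.2.1 ∧ u.2.2 = v.2.2)

theorem AgreeTwice.refl {A B C : Type*} (u : A × B × C) : AgreeTwice u u := Or.inl ⟨rfl, rfl⟩

/-! ### Arrays as sets of entries -/

/-- The set of entries of an array. -/
def arrayEntries {r s n : ℕ} (P : Fin r → Fin s → Option (Fin n)) :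
    Finset (Fin r × Fin s × Fin n) :=
  Finset.univ.filter fun u => P u.1 u.2.1 = some u.2.2

theorem mem_arrayEntries {r s n : ℕ} {P : Fin r → Fin s → Option (Fin n)}
    {u : Fin r × Fin s × Fin n} : u ∈ arrayEntries P ↔ P u.1 u.2.1 = some u.2.2 := by
  simp [arrayEntries]

theorem arrayEntries_injective {r s n : ℕ} :
    Function.Injective (arrayEntries : (Fin r → Fin s → Option (Fin n)) → _) := by
  intro P Q h
  funext i j
  ext k
  have := congrArg (fun S => (i, j, k) ∈ S) h
  simpa [mem_arrayEntries] using this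

theorem card_arrayEntries {r s n : ℕ} (P : Fin r → Fin s → Option (Fin n)) :
    (arrayEntries P).card = arraySize P := by
  unfold arraySize
  refine Finset.card_bij (fun u _ => (u.1, u.2.1)) ?_ ?_ ?_
  · intro u hu
    simp [mem_arrayEntries.1 hu]
  · rintro ⟨i, j, k⟩ hu ⟨i', j', k'⟩ hv h
    obtain ⟨rfl, rfl⟩ := Prod.mk.inj h
    have hu := mem_arrayEntries.1 hu
    have hv := mem_arrayEntries.1 hv
    simp_all
  · rintro ⟨i, j⟩ h
    obtain ⟨k, hk⟩ := Option.isSome_iff_exists.1 (Finset.mem_filter.1 h).2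
    exact ⟨(i, j, k), mem_arrayEntries.2 hk, rfl⟩

theorem isPartialLatinRectangle_iff_pairwise_arrayEntries {r s n : ℕ}
    (P : Fin r → Fin s → Option (Fin n)) :
    IsPartialLatinRectangle P ↔
      (arrayEntries P : Set (Fin r × Fin s × Fin n)).Pairwise fun u v => ¬ AgreeTwice u v := by
  constructor
  · rintro ⟨hrow, hcol⟩ ⟨i, j, k⟩ hu ⟨i', j', k'⟩ hv hne h
    have hu := mem_arrayEntries.1 hu
    have hv := mem_arrayEntries.1 hv
    apply hne
    rcases h with ⟨h₁, h₂⟩ | ⟨h₁, h₂⟩ | ⟨h₁, h₂⟩ <;> dsimp only at * <;> subst h₁ <;> subst h₂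
    · simp_all
    · rw [hrow _ _ _ _ hu hv]
    · rw [hcol _ _ _ _ hu hv]
  · intro h
    refine ⟨fun i j j' k hj hj' => ?_, fun i i' j k hi hi' => ?_⟩
    · by_contra hne
      exact h (x := (i, j, k)) (mem_arrayEntries.2 hj) (y := (i, j', k)) (mem_arrayEntries.2 hj')
        (by simpa using hne) (Or.inr (Or.inl ⟨rfl, rfl⟩))
    · by_contra hne
      exact h (x := (i, j, k)) (mem_arrayEntries.2 hi) (y := (i', j, k)) (mem_arrayEntries.2 hi')
        (by simpa using hne) (Or.inr (Or.inr ⟨rfl, rfl⟩))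

/-- Only agreement in row and column matters here: its absence makes `S` the graph of a partial
function on cells. -/
theorem exists_arrayEntries_eq {r s n : ℕ} {S : Finset (Fin r × Fin s × Fin n)}
    (hS : (S : Set (Fin r × Fin s × Fin n)).Pairwise fun u v => ¬ AgreeTwice u v) :
    ∃ P : Fin r → Fin s → Option (Fin n), arrayEntries P = S := by
  classical
  refine ⟨fun i j => if h : ∃ k, (i, j, k) ∈ S then some h.choose else none, ?_⟩
  ext ⟨i, j, k⟩
  rw [mem_arrayEntries]
  dsimp only
  constructor
  · intro h
    split_ifs at h with hex
    rw [← Option.some.inj h]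
    exact hex.choose_spec
  · intro h
    have hex : ∃ k, (i, j, k) ∈ S := ⟨k, h⟩
    rw [dif_pos hex]
    by_contra hne
    exact hS hex.choose_spec h (fun e => hne (by simpa using e)) (Or.inl ⟨rfl, rfl⟩)

open Classical in
/-- The partial Latin rectangles of size `m` correspond to the `m`-sets of entries no two of which
agree twice. -/
theorem ncard_partialLatinRectanglesOfSize (r s n m : ℕ) :
    (partialLatinRectanglesOfSize r s n m).ncard =
      (Finset.univ.filter fun S : Finset (Fin r × Fin s × Fin n) =>
        S.card = m ∧ (S : Set (Fin r × Fin s × Fin n)).Pairwise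
          fun u v => ¬ AgreeTwice u v).card := by
  rw [← Set.ncard_coe_finset, ← Set.ncard_image_of_injective _ arrayEntries_injective]
  congr 1
  ext S
  simp only [Set.mem_image, Finset.coe_filter, Finset.mem_univ, true_and, Set.mem_ofPred_eq,
    partialLatinRectanglesOfSize, partialLatinRectangles]
  constructor
  · rintro ⟨P, ⟨hP, hm⟩, rfl⟩
    exact ⟨(card_arrayEntries P).trans hm,
      (isPartialLatinRectangle_iff_pairwise_arrayEntries P).1 hP⟩
  · rintro ⟨hm, hS⟩
    obtain ⟨P, rfl⟩ := exists_arrayEntries_eq hS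
    exact ⟨P, ⟨(isPartialLatinRectangle_iff_pairwise_arrayEntries P).2 hS,
      (card_arrayEntries P).symm.trans hm⟩, rfl⟩

/-! ### Ordered tuples of entries -/

/-- A set with `m` elements is enumerated by `m!` tuples. -/
theorem card_filter_injective_image_eq {T : Type*} [Fintype T] [DecidableEq T] {m : ℕ}
    {S : Finset T} (hS : S.card = m) :
    (Finset.univ.filter fun t : Fin m → T =>
      Function.Injective t ∧ Finset.univ.image t = S).card = m.factorial := by
  have e : (Fin m ≃ S) ≃
      {t : Fin m → T // Function.Injective t ∧ Finset.univ.image t = S} :=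
    { toFun := fun e => ⟨fun i => e i, Subtype.val_injective.comp e.injective, by
        ext x
        simp only [Finset.mem_image, Finset.mem_univ, true_and]
        constructor
        · rintro ⟨i, rfl⟩
          exact (e i).2
        · intro hx
          exact ⟨e.symm ⟨x, hx⟩, by simp⟩⟩
      invFun := fun t => Equiv.ofBijective
        (fun i => ⟨t.1 i, t.2.2.le (Finset.mem_image_of_mem _ (Finset.mem_univ i))⟩)
        ⟨fun i j h => t.2.1 (congrArg Subtype.val h), fun x => by
          have hx : (x : T) ∈ Finset.univ.image t.1 := t.2.2.ge x.2
          obtain ⟨i, -, hi⟩ := Finset.mem_image.1 hx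
          exact ⟨i, Subtype.ext hi⟩⟩
      left_inv := fun e => by ext i; rfl
      right_inv := fun t => by ext i; rfl }
  rw [← Fintype.card_subtype, ← Fintype.card_congr e,
    Fintype.card_equiv (Fintype.equivOfCardEq (by simp [hS])), Fintype.card_fin]

/-- Ordering the elements of the `m`-sets whose elements are pairwise related by `R`. -/
theorem factorial_mul_card_pairwise {T : Type*} [Fintype T] (R : T → T → Prop)
    (hR : ∀ u, ¬ R u u) (m : ℕ)
    [DecidablePred fun S : Finset T => S.card = m ∧ (S : Set T).Pairwise R]
    [DecidablePred fun t : Fin m → T => Pairwise fun i j => R (t i) (t j)] :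
    m.factorial * (Finset.univ.filter fun S : Finset T =>
        S.card = m ∧ (S : Set T).Pairwise R).card =
      (Finset.univ.filter fun t : Fin m → T => Pairwise fun i j => R (t i) (t j)).card := by
  classical
  have hinj : ∀ t : Fin m → T, (Pairwise fun i j => R (t i) (t j)) → Function.Injective t := by
    intro t ht i j hij
    by_contra hne
    have h : R (t i) (t j) := ht hne
    exact hR _ (hij ▸ h)
  have himg : ∀ t : Fin m → T, Function.Injective t →
      (((Finset.univ.image t : Finset T) : Set T).Pairwise R ↔
        Pairwise fun i j => R (t i) (t j)) := by
    intro t ht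
    rw [Finset.coe_image, Finset.coe_univ, ht.injOn.pairwise_image, Set.pairwise_univ]
  -- Group the tuples by their image; each admissible `m`-set is the image of `m!` of them.
  rw [Finset.card_eq_sum_card_fiberwise (f := fun t : Fin m → T => Finset.univ.image t)
    (t := Finset.univ.filter fun S : Finset T => S.card = m ∧ (S : Set T).Pairwise R)]
  · rw [Finset.sum_congr rfl (g := fun _ => m.factorial), Finset.sum_const, smul_eq_mul, mul_comm]
    intro S hS
    obtain ⟨hm, hS⟩ := (Finset.mem_filter.1 hS).2
    rw [← card_filter_injective_image_eq hm, Finset.filter_filter]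
    congr 1
    ext t
    simp only [Finset.mem_filter, Finset.mem_univ, true_and]
    constructor
    · rintro ⟨ht, he⟩
      exact ⟨hinj t ht, he⟩
    · rintro ⟨ht, he⟩
      exact ⟨(himg t ht).1 (by rwa [he]), he⟩
  · intro t ht
    have ht := (Finset.mem_filter.1 (Finset.mem_coe.1 ht)).2
    refine Finset.mem_coe.2 (Finset.mem_filter.2 ⟨Finset.mem_univ _, ?_, ?_⟩)
    · rw [Finset.card_image_of_injective _ (hinj t ht)]
      simp
    · exact (himg t (hinj t ht)).2 ht

/-! ### Set partitions and their enumeration -/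

/-- `c` is the canonical representative of a set partition of `{0, …, m - 1}`: it sends each
element to the least element of its block and fixes all `i ≥ m`. -/
structure IsCanonical (m : ℕ) (c : ℕ → ℕ) : Prop where
  le : ∀ i, c i ≤ i
  idem : ∀ i, c (c i) = c i
  fixed : ∀ i, m ≤ i → c i = i

/-- The list of all canonical representatives of the set partitions of `{0, …, m - 1}`. -/
def canonicalMaps : ℕ → List (ℕ → ℕ)
  | 0 => [id]
  | m + 1 => (canonicalMaps m).flatMap fun c =>
      ((List.range (m + 1)).filter fun x => c x == x).map fun x i => if i = m then x else c i

theorem mem_canonicalMaps {m : ℕ} {c : ℕ → ℕ} : c ∈ canonicalMaps m ↔ IsCanonical m c := by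
  induction m generalizing c with
  | zero =>
    simp only [canonicalMaps, List.mem_singleton]
    constructor
    · rintro rfl
      exact ⟨fun _ => le_rfl, fun _ => rfl, fun _ _ => rfl⟩
    · intro h
      exact funext fun i => h.fixed i (Nat.zero_le i)
  | succ m ih =>
    simp only [canonicalMaps, List.mem_flatMap, List.mem_map, List.mem_filter, List.mem_range,
      beq_iff_eq, ih]
    constructor
    · rintro ⟨c, hc, x, ⟨hx, hcx⟩, rfl⟩
      have hm := hc.fixed m le_rfl
      refine ⟨fun i => ?_, fun i => ?_, fun i hi => ?_⟩
      · have := hc.le i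
        split_ifs <;> omega
      · have h₁ := hc.idem i
        have h₂ := hc.le i
        have h₃ := hc.fixed i
        split_ifs <;> omega
      · rw [if_neg (by omega)]
        exact hc.fixed i (by omega)
    · intro h
      -- Since `m` is the last element, it is the least of its block only if it is a singleton.
      -- Making it fixed therefore recovers the representative on `m` elements.
      have hlt : ∀ i, i ≠ m → c i ≠ m := by
        intro i hi him
        have h₁ := h.le i
        have h₂ := h.fixed i
        omega
      refine ⟨fun i => if i = m then m else c i, ⟨fun i => ?_, fun i => ?_, fun i hi => ?_⟩,
        c m, ⟨Nat.lt_succ_of_le (h.le m), ?_⟩, ?_⟩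
      · have := h.le i
        split_ifs <;> omega
      · have := h.idem i
        have := hlt i
        split_ifs <;> omega
      · have := h.fixed i
        split_ifs <;> omega
      · have := h.idem m
        change (if c m = m then m else c (c m)) = c m
        split_ifs <;> omega
      · funext i
        change (if i = m then c m else if i = m then m else c i) = c i
        split_ifs with hi
        · rw [hi]
        · rfl

theorem nodup_canonicalMaps (m : ℕ) : (canonicalMaps m).Nodup := by
  induction m with
  | zero => simp [canonicalMaps]
  | succ m ih =>
    refine List.nodup_flatMap.2 ⟨fun c _ => ?_, ih.pairwise_of_forall_ne ?_⟩
    · refine (List.nodup_range.filter _).map fun x y h => ?_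
      simpa using congrFun h m
    · intro c hc d hd hne e he hf
      obtain ⟨x, -, rfl⟩ := List.mem_map.1 he
      obtain ⟨y, -, h⟩ := List.mem_map.1 hf
      refine hne (funext fun i => ?_)
      by_cases hi : i = m
      · rw [hi, (mem_canonicalMaps.1 hc).fixed m le_rfl, (mem_canonicalMaps.1 hd).fixed m le_rfl]
      · simpa [hi] using (congrFun h i).symm

/-- The set partitions of `{0, …, m - 1}`, given by their canonical representatives. -/
def canonicalFinset (m : ℕ) : Finset (ℕ → ℕ) := ⟨canonicalMaps m, nodup_canonicalMaps m⟩

theorem mem_canonicalFinset {m : ℕ} {c : ℕ → ℕ} : c ∈ canonicalFinset m ↔ IsCanonical m c :=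
  mem_canonicalMaps

/-- The number of blocks of a set partition of `{0, …, m - 1}`. -/
def blockCount (m : ℕ) (c : ℕ → ℕ) : ℕ := ((List.range m).filter fun i => c i == i).length

theorem blockCount_eq_card (m : ℕ) (c : ℕ → ℕ) :
    blockCount m c = Fintype.card {i : Fin m // c i = i} := by
  have h : blockCount m c = ((Finset.range m).filter fun i => c i = i).card := by
    simp [blockCount, Finset.card, Finset.filter, Finset.range, Multiset.range, beq_eq_decide]
  rw [h, Fintype.card_subtype]
  symm
  refine Finset.card_bij (fun i _ => (i : ℕ)) ?_ ?_ ?_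
  · intro i hi
    simpa using hi
  · intro i _ j _ hij
    exact Fin.ext hij
  · intro i hi
    obtain ⟨him, hi⟩ := Finset.mem_filter.1 hi
    exact ⟨⟨i, Finset.mem_range.1 him⟩, by simpa using hi, rfl⟩

/-! ### Fibre partitions of functions -/

/-- The canonical representative of the partition into fibres of `f`. -/
def fibrePartition {m : ℕ} {α : Type*} [DecidableEq α] (f : Fin m → α) (i : ℕ) : ℕ :=
  if h : i < m then Nat.find (p := fun j => ∃ hj : j < m, f ⟨j, hj⟩ = f ⟨i, h⟩) ⟨i, h, rfl⟩ else i

section fibrePartition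

variable {m : ℕ} {α : Type*} [DecidableEq α] (f : Fin m → α)

theorem fibrePartition_le (i : ℕ) : fibrePartition f i ≤ i := by
  unfold fibrePartition
  split_ifs with h
  · exact Nat.find_min' _ ⟨h, rfl⟩
  · exact le_rfl

theorem fibrePartition_lt (i : Fin m) : fibrePartition f i < m :=
  (fibrePartition_le f i).trans_lt i.2

theorem apply_fibrePartition (i : Fin m) :
    f ⟨fibrePartition f i, fibrePartition_lt f i⟩ = f i := by
  have h := Nat.find_spec (p := fun j => ∃ hj : j < m, f ⟨j, hj⟩ = f i) ⟨i, i.2, rfl⟩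
  obtain ⟨hj, h⟩ := h
  rw [← h]
  congr 2
  simp [fibrePartition]

theorem fibrePartition_eq_iff {i j : Fin m} :
    fibrePartition f i = fibrePartition f j ↔ f i = f j := by
  constructor
  · intro h
    rw [← apply_fibrePartition f i, ← apply_fibrePartition f j]
    congr 2
  · intro h
    simp only [fibrePartition, i.2, j.2, dif_pos, Fin.eta, h]

theorem isCanonical_fibrePartition : IsCanonical m (fibrePartition f) where
  le := fibrePartition_le f
  idem i := by
    by_cases h : i < m
    · exact (fibrePartition_eq_iff f (i := ⟨_, fibrePartition_lt f ⟨i, h⟩⟩) (j := ⟨i, h⟩)).2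
        (apply_fibrePartition f ⟨i, h⟩)
    · simp [fibrePartition, h]
  fixed i hi := by simp [fibrePartition, hi]

end fibrePartition

/-- Both maps send `i` to the least element of the same block, so each value bounds the other. -/
theorem IsCanonical.eq_fibrePartition {m : ℕ} {c : ℕ → ℕ} (hc : IsCanonical m c) {α : Type*}
    [DecidableEq α] (f : Fin m → α) (h : ∀ i j : Fin m, f i = f j ↔ c i = c j) :
    fibrePartition f = c := by
  funext i
  by_cases hi : i < m
  · have hlt := (hc.le i).trans_lt hi
    apply le_antisymm
    · have := (fibrePartition_eq_iff f (i := ⟨c i, hlt⟩) (j := ⟨i, hi⟩)).2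
        ((h _ _).2 (hc.idem i))
      dsimp only at this
      rw [← this]
      exact fibrePartition_le f _
    · have := (h _ _).1 (apply_fibrePartition f ⟨i, hi⟩)
      dsimp only at this
      rw [← this]
      exact hc.le _
  · rw [hc.fixed i (not_lt.1 hi), (isCanonical_fibrePartition f).fixed i (not_lt.1 hi)]

-- The fixed points of `c` represent its blocks, so a function with fibre partition `c` is an
-- injection of these fixed points into `Fin n`.
open Classical in
theorem card_filter_fibrePartition_eq {m n : ℕ} {c : ℕ → ℕ} (hc : IsCanonical m c) :
    (Finset.univ.filter fun f : Fin m → Fin n => fibrePartition f = c).card =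
      n.descFactorial (blockCount m c) := by
  have hlt : ∀ i : Fin m, c i < m := fun i => (hc.le i).trans_lt i.2
  have key : ∀ f : Fin m → Fin n, fibrePartition f = c → ∀ i j : Fin m, c i = c j ↔ f i = f j := by
    rintro f rfl i j
    exact fibrePartition_eq_iff f
  let e : {f : Fin m → Fin n // fibrePartition f = c} ≃ ({i : Fin m // c i = i} ↪ Fin n) :=
    { toFun := fun f => ⟨fun i => f.1 i, fun i j h => Subtype.ext <| Fin.ext <| by
        have := (key f.1 f.2 i j).2 h
        rwa [i.2, j.2] at this⟩
      invFun := fun e => ⟨fun i => e ⟨⟨c i, hlt i⟩, hc.idem i⟩,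
        hc.eq_fibrePartition _ fun i j => by simp⟩
      left_inv := fun f => Subtype.ext <| funext fun i => (key f.1 f.2 _ _).1 (hc.idem i)
      right_inv := fun e => by
        ext i
        exact congrArg (fun j => (e j : ℕ)) (Subtype.ext (Fin.ext i.2)) }
  rw [← Fintype.card_subtype, Fintype.card_congr e, Fintype.card_embedding_eq, Fintype.card_fin,
    blockCount_eq_card]

/-! ### Trivial meets as disjoint bit masks -/

/-- The pairs of distinct elements of `{0, …, m - 1}` in the same block, as a bit mask. -/
def pairMask (m : ℕ) (c : ℕ → ℕ) : ℕ :=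
  Nat.ofBits fun t : Fin (m * m) => (t % m : ℕ).blt (t / m) && (c (t / m) == c (t % m))

/-- Bit `i * m + j` with `j < i` records whether `i` and `j` share a block, so a common bit is a
pair joined in both partitions. -/
theorem pairMask_land_eq_zero_iff {m : ℕ} {c d : ℕ → ℕ} :
    pairMask m c &&& pairMask m d = 0 ↔ ∀ i j : Fin m, i ≠ j → ¬ (c i = c j ∧ d i = d j) := by
  have hlt : ∀ i j : Fin m, (i * m + j : ℕ) < m * m := fun i j => by
    have h₁ := i.2
    have h₂ := j.2
    nlinarith
  have hbit : ∀ (e : ℕ → ℕ) (i j : Fin m),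
      (pairMask m e).testBit (i * m + j) = (decide (j < i) && decide (e i = e j)) := by
    intro e i j
    have hm : 0 < m := i.pos
    have hdiv : (i * m + j : ℕ) / m = i := by
      rw [mul_comm, Nat.mul_add_div hm, Nat.div_eq_of_lt j.2, add_zero]
    have hmod : (i * m + j : ℕ) % m = j := by
      rw [mul_comm, Nat.mul_add_mod, Nat.mod_eq_of_lt j.2]
    rw [pairMask, Nat.testBit_ofBits_lt _ _ (hlt i j)]
    dsimp only
    rw [hdiv, hmod, Bool.eq_iff_iff]
    simp
  constructor
  · intro h
    have hlt' : ∀ i j : Fin m, j < i → ¬ (c i = c j ∧ d i = d j) := by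
      rintro i j hij ⟨h₁, h₂⟩
      have := congrArg (fun x => x.testBit (i * m + j)) h
      simp [hbit, hij, h₁, h₂] at this
    rintro i j hij ⟨h₁, h₂⟩
    rcases lt_or_gt_of_ne hij with hij | hij
    · exact hlt' j i hij ⟨h₁.symm, h₂.symm⟩
    · exact hlt' i j hij ⟨h₁, h₂⟩
  · intro h
    apply Nat.eq_of_testBit_eq
    intro t
    rw [Nat.zero_testBit, Nat.testBit_land]
    by_cases ht : t < m * m
    · have hm : 0 < m := Nat.pos_of_ne_zero (by rintro rfl; simp at ht)
      have h₁ := hbit c ⟨t / m, Nat.div_lt_of_lt_mul ht⟩ ⟨t % m, Nat.mod_lt _ hm⟩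
      have h₂ := hbit d ⟨t / m, Nat.div_lt_of_lt_mul ht⟩ ⟨t % m, Nat.mod_lt _ hm⟩
      have h₃ := h ⟨t / m, Nat.div_lt_of_lt_mul ht⟩ ⟨t % m, Nat.mod_lt _ hm⟩
      have h₄ : t / m * m + t % m = t := Nat.div_add_mod' t m
      dsimp only at h₁ h₂ h₃
      rw [h₄] at h₁ h₂
      rw [h₁, h₂, Bool.eq_false_iff]
      simp only [ne_eq, Bool.and_eq_true, decide_eq_true_eq, not_and, Fin.mk_lt_mk, and_imp,
        Fin.mk.injEq] at h₃ ⊢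
      intro h₅ h₆ _
      exact h₃ h₅.ne' h₆
    · rw [pairMask, Nat.testBit_ofBits_ge _ _ (not_lt.1 ht), Bool.false_and]

theorem sum_fibrePartition (m n : ℕ) (F : (ℕ → ℕ) → ℕ) :
    ∑ f : Fin m → Fin n, F (fibrePartition f) =
      ∑ c ∈ canonicalFinset m, n.descFactorial (blockCount m c) * F c := by
  classical
  rw [← Finset.sum_fiberwise_of_maps_to (t := canonicalFinset m)
    fun f _ => mem_canonicalFinset.2 (isCanonical_fibrePartition f)]
  refine Finset.sum_congr rfl fun c hc => ?_
  rw [← card_filter_fibrePartition_eq (mem_canonicalFinset.1 hc), Finset.sum_congr rfl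
    (g := fun _ => F c) fun f hf => by rw [(Finset.mem_filter.1 hf).2], Finset.sum_const,
    smul_eq_mul]

/-- The pair masks of the set partitions of `{0, …, m - 1}` into `a` blocks. -/
def blockMasks (m a : ℕ) : List ℕ :=
  ((canonicalMaps m).filter fun c => blockCount m c == a).map (pairMask m)

theorem blockCount_le (m : ℕ) (c : ℕ → ℕ) : blockCount m c ≤ m :=
  (List.length_filter_le _ _).trans List.length_range.le

theorem sum_canonicalFinset (m : ℕ) (w G : ℕ → ℕ) :
    ∑ c ∈ canonicalFinset m, w (blockCount m c) * G (pairMask m c) =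
      ∑ a ∈ Finset.range (m + 1), w a * ((blockMasks m a).map G).sum := by
  rw [← Finset.sum_fiberwise_of_maps_to (t := Finset.range (m + 1)) (g := blockCount m)
    fun c _ => Finset.mem_range.2 (Nat.lt_succ_of_le (blockCount_le m c))]
  refine Finset.sum_congr rfl fun a _ => ?_
  rw [Finset.sum_congr rfl (g := fun c => w a * G (pairMask m c)) fun c hc => by
    rw [(Finset.mem_filter.1 hc).2], ← Finset.mul_sum]
  congr 1
  simp only [blockMasks, List.map_map, beq_eq_decide]
  rfl

/-! ### Counting by triples of partitions -/

/-- The number of triples in `X × Y × Z` whose components have pairwise disjoint binary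
expansions. -/
def disjointTriples (X Y Z : List ℕ) : ℕ :=
  (X.map fun x => (Y.map fun y => (Z.map fun z =>
    if x &&& y = 0 ∧ x &&& z = 0 ∧ y &&& z = 0 then 1 else 0).sum).sum).sum

theorem List.sum_map_sum_comm {α β : Type*} (X : List α) (Y : List β) (f : α → β → ℕ) :
    (X.map fun x => (Y.map fun y => f x y).sum).sum =
      (Y.map fun y => (X.map fun x => f x y).sum).sum := by
  induction X with
  | nil => simp
  | cons x X ih => simp [ih, List.sum_map_add]

theorem disjointTriples_swap_left (X Y Z : List ℕ) :
    disjointTriples X Y Z = disjointTriples Y X Z := by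
  unfold disjointTriples
  rw [List.sum_map_sum_comm]
  simp only [Nat.land_comm, and_comm]

theorem disjointTriples_swap_right (X Y Z : List ℕ) :
    disjointTriples X Y Z = disjointTriples X Z Y := by
  unfold disjointTriples
  simp only [List.sum_map_sum_comm Y Z]
  simp only [Nat.land_comm, and_left_comm]

theorem not_agreeTwice_iff_pairMask_disjoint {m : ℕ} {A B C : Type*} [DecidableEq A]
    [DecidableEq B] [DecidableEq C] (t : Fin m → A × B × C) :
    (Pairwise fun i j => ¬ AgreeTwice (t i) (t j)) ↔
      pairMask m (fibrePartition fun i => (t i).1) &&&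
        pairMask m (fibrePartition fun i => (t i).2.1) = 0 ∧
      pairMask m (fibrePartition fun i => (t i).1) &&&
        pairMask m (fibrePartition fun i => (t i).2.2) = 0 ∧
      pairMask m (fibrePartition fun i => (t i).2.1) &&&
        pairMask m (fibrePartition fun i => (t i).2.2) = 0 := by
  simp only [pairMask_land_eq_zero_iff, fibrePartition_eq_iff, AgreeTwice, not_or, Pairwise]
  grind

theorem factorial_mul_ncard_partialLatinRectanglesOfSize (r s n m : ℕ) :
    m.factorial * (partialLatinRectanglesOfSize r s n m).ncard =
      ∑ a ∈ Finset.range (m + 1), r.descFactorial a *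
        ∑ b ∈ Finset.range (m + 1), s.descFactorial b *
          ∑ c ∈ Finset.range (m + 1), n.descFactorial c *
            disjointTriples (blockMasks m a) (blockMasks m b) (blockMasks m c) := by
  classical
  have hsum : ∀ (n : ℕ) (G : ℕ → ℕ), ∑ f : Fin m → Fin n, G (pairMask m (fibrePartition f)) =
      ∑ a ∈ Finset.range (m + 1), n.descFactorial a * ((blockMasks m a).map G).sum := by
    intro n G
    rw [sum_fibrePartition m n fun c => G (pairMask m c)]
    exact sum_canonicalFinset m _ G
  have hcomm : ∀ (X : List ℕ) (G : ℕ → ℕ → ℕ) (w : ℕ → ℕ),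
      (X.map fun x => ∑ a ∈ Finset.range (m + 1), w a * G x a).sum =
        ∑ a ∈ Finset.range (m + 1), w a * (X.map fun x => G x a).sum := by
    intro X G w
    induction X with
    | nil => simp
    | cons x X ih => simp [ih, mul_add, Finset.sum_add_distrib]
  rw [ncard_partialLatinRectanglesOfSize, factorial_mul_card_pairwise (fun u v => ¬ AgreeTwice u v)
    (fun u h => h (AgreeTwice.refl u)), Finset.card_filter,
    ← ((Equiv.arrowProdEquivProdArrow (Fin m) (fun _ => Fin r) fun _ => Fin s × Fin n).trans
      (Equiv.prodCongr (Equiv.refl _) (Equiv.arrowProdEquivProdArrow (Fin m) (fun _ => Fin s)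
        fun _ => Fin n))).symm.sum_comp, Fintype.sum_prod_type]
  simp only [Fintype.sum_prod_type, not_agreeTwice_iff_pairMask_disjoint, Equiv.symm_trans_apply,
    Equiv.arrowProdEquivProdArrow, Equiv.prodCongr_symm, Equiv.coe_fn_symm_mk,
    Equiv.prodCongr_apply, Prod.map_apply, Equiv.refl_symm, Equiv.refl_apply]
  let I : ℕ → ℕ → ℕ → ℕ := fun x y z => if x &&& y = 0 ∧ x &&& z = 0 ∧ y &&& z = 0 then 1 else 0
  -- The sums over symbol, column and row functions become sums over masks, innermost first.
  refine (Finset.sum_congr rfl fun f _ => Finset.sum_congr rfl fun g _ =>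
    hsum n (I (pairMask m (fibrePartition f)) (pairMask m (fibrePartition g)))).trans ?_
  refine (Finset.sum_congr rfl fun f _ => hsum s fun y => ∑ c ∈ Finset.range (m + 1),
    n.descFactorial c * ((blockMasks m c).map (I (pairMask m (fibrePartition f)) y)).sum).trans ?_
  refine (hsum r fun x => ∑ b ∈ Finset.range (m + 1), s.descFactorial b *
    ((blockMasks m b).map fun y => ∑ c ∈ Finset.range (m + 1),
      n.descFactorial c * ((blockMasks m c).map (I x y)).sum).sum).trans ?_
  simp only [hcomm]
  rfl

/-! ### Testing a list of masks inside one number -/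

theorem Nat.add_two_pow_mul_land {k a b p q : ℕ} (ha : a < 2 ^ k) (hb : b < 2 ^ k) :
    (a + 2 ^ k * p) &&& (b + 2 ^ k * q) = (a &&& b) + 2 ^ k * (p &&& q) := by
  apply Nat.eq_of_testBit_eq
  intro i
  rw [Nat.testBit_land, add_comm a, add_comm b, add_comm (a &&& b),
    Nat.testBit_two_pow_mul_add _ ha, Nat.testBit_two_pow_mul_add _ hb,
    Nat.testBit_two_pow_mul_add _ (Nat.and_lt_two_pow _ hb)]
  split_ifs <;> rw [Nat.testBit_land]

/-- The natural number whose digits in base `2 ^ (k + 1)` are the elements of `Z`. -/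
noncomputable def packDigits (k : ℕ) (Z : List ℕ) : ℕ :=
  List.rec 0 (fun z _ p => z + 2 ^ (k + 1) * p) Z

/-- The natural number whose digits in base `2 ^ (k + 1)` are ones, one for each element of `Z`. -/
noncomputable def packOnes (k : ℕ) (Z : List ℕ) : ℕ :=
  List.rec 0 (fun _ _ p => 1 + 2 ^ (k + 1) * p) Z

/-- The number of elements of `Z` whose binary expansion meets that of `u`, computed for all
elements at once from `packOnes k Z` and `packDigits k Z`. -/
def packedCount (k u o p : ℕ) : ℕ :=
  ((((u * o) &&& p) + (2 ^ k - 1) * o) &&& (2 ^ k * o)) / 2 ^ k % (2 ^ (k + 1) - 1)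

/-- Adding `2 ^ k - 1` carries into the guard bit `k` exactly when `v ≠ 0`. -/
theorem add_two_pow_sub_one_land {k v : ℕ} (hv : v < 2 ^ k) :
    (v + (2 ^ k - 1)) &&& 2 ^ k = 2 ^ k * if v = 0 then 0 else 1 := by
  have hk := Nat.two_pow_pos k
  rw [Nat.and_two_pow, Nat.testBit_eq_decide_div_mod_eq, mul_comm]
  congr 1
  split_ifs with h
  · rw [h, zero_add, Nat.div_eq_of_lt (by omega)]
    rfl
  · rw [Nat.div_eq_of_lt_le (k := 1) (by omega) (by omega)]
    rfl

/-- Multiplying by `packOnes` copies `u` into every digit. Each digit has `k + 1` bits, so the guard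
carry stays within its own digit and the digits can be treated separately. -/
theorem guarded_land_packDigits {k u : ℕ} (hu : u < 2 ^ k) (Z : List ℕ) (hZ : ∀ z ∈ Z, z < 2 ^ k) :
    (((u * packOnes k Z) &&& packDigits k Z) + (2 ^ k - 1) * packOnes k Z) &&&
      (2 ^ k * packOnes k Z) =
    2 ^ k * packDigits k (Z.map fun z => if u &&& z = 0 then 0 else 1) := by
  have hk := Nat.two_pow_pos k
  have hk' : 2 ^ (k + 1) = 2 ^ k + 2 ^ k := by rw [pow_succ, mul_two]
  induction Z with
  | nil => simp [packOnes, packDigits]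
  | cons z Z ih =>
    have hz := hZ z List.mem_cons_self
    have ih := ih fun z hz => hZ z (List.mem_cons_of_mem _ hz)
    have hv : u &&& z < 2 ^ k := Nat.and_lt_two_pow _ hz
    change (((u * (1 + 2 ^ (k + 1) * packOnes k Z)) &&& (z + 2 ^ (k + 1) * packDigits k Z)) +
      (2 ^ k - 1) * (1 + 2 ^ (k + 1) * packOnes k Z)) &&& (2 ^ k * (1 + 2 ^ (k + 1) * packOnes k Z))
      = 2 ^ k * ((if u &&& z = 0 then 0 else 1) + 2 ^ (k + 1) * packDigits k _)
    rw [show u * (1 + 2 ^ (k + 1) * packOnes k Z) = u + 2 ^ (k + 1) * (u * packOnes k Z) by ring,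
      Nat.add_two_pow_mul_land (by omega) (by omega),
      show ∀ A M : ℕ, A + 2 ^ (k + 1) * ((u * packOnes k Z) &&& packDigits k Z) +
        M * (1 + 2 ^ (k + 1) * packOnes k Z) = (A + M) +
          2 ^ (k + 1) * (((u * packOnes k Z) &&& packDigits k Z) + M * packOnes k Z) by
        intros; ring,
      show 2 ^ k * (1 + 2 ^ (k + 1) * packOnes k Z) =
        2 ^ k + 2 ^ (k + 1) * (2 ^ k * packOnes k Z) by ring,
      Nat.add_two_pow_mul_land (by omega) (by omega), ih, add_two_pow_sub_one_land hv]
    ring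

/-- Casting out: the base is 1 modulo the base minus one. -/
theorem packDigits_modEq_sum (k : ℕ) (Z : List ℕ) :
    packDigits k Z ≡ Z.sum [MOD 2 ^ (k + 1) - 1] := by
  induction Z with
  | nil => rfl
  | cons z Z ih =>
    rw [List.sum_cons]
    refine Nat.ModEq.add_left z ?_
    have h : 2 ^ (k + 1) ≡ 1 [MOD 2 ^ (k + 1) - 1] :=
      (Nat.modEq_iff_dvd' Nat.one_le_two_pow).2 dvd_rfl |>.symm
    have := h.mul ih
    rwa [one_mul] at this

theorem packedCount_eq {k u : ℕ} (hu : u < 2 ^ k) {Z : List ℕ} (hZ : ∀ z ∈ Z, z < 2 ^ k)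
    (hlen : Z.length < 2 ^ k) :
    packedCount k u (packOnes k Z) (packDigits k Z) =
      (Z.map fun z => if u &&& z = 0 then 0 else 1).sum := by
  have hk' : 2 ^ (k + 1) = 2 ^ k + 2 ^ k := by rw [pow_succ, mul_two]
  have hle : ∀ Z : List ℕ, (Z.map fun z => if u &&& z = 0 then 0 else 1).sum ≤ Z.length := by
    intro Z
    induction Z with
    | nil => simp
    | cons z Z ih =>
      rw [List.map_cons, List.sum_cons, List.length_cons]
      split_ifs <;> omega
  rw [packedCount, guarded_land_packDigits hu Z hZ, Nat.mul_div_cancel_left _ (Nat.two_pow_pos k),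
    packDigits_modEq_sum, Nat.mod_eq_of_lt]
  -- The count is at most the length, hence below the modulus, so reduction loses nothing.
  have := hle Z
  omega

/-- The number of pairs `(y, z)` in `Y × Z` such that the binary expansions of `x`, `y` and `z` are
pairwise disjoint, for a list `Z` of length `l` packed as `o` and `p`. -/
noncomputable def packedPairs (k l o p x : ℕ) (Y : List ℕ) : ℕ :=
  List.rec 0 (fun y _ t => Bool.rec 0 (l - packedCount k (x ||| y) o p) (Nat.beq (x &&& y) 0) + t) Y

/-- A fast version of `disjointTriples` for numbers less than `2 ^ k`. -/
noncomputable def packedTriples (k l o p : ℕ) (Y X : List ℕ) : ℕ :=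
  List.rec 0 (fun x _ t => packedPairs k l o p x Y + t) X

theorem lor_land_eq_zero_iff {x y z : ℕ} : (x ||| y) &&& z = 0 ↔ x &&& z = 0 ∧ y &&& z = 0 := by
  rw [Nat.and_or_distrib_right, Nat.or_eq_zero_iff]

theorem packedPairs_eq {k x : ℕ} (hx : x < 2 ^ k) {Y Z : List ℕ} (hY : ∀ y ∈ Y, y < 2 ^ k)
    (hZ : ∀ z ∈ Z, z < 2 ^ k) (hlen : Z.length < 2 ^ k) :
    packedPairs k Z.length (packOnes k Z) (packDigits k Z) x Y = (Y.map fun y => (Z.map fun z =>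
      if x &&& y = 0 ∧ x &&& z = 0 ∧ y &&& z = 0 then 1 else 0).sum).sum := by
  -- The packed count finds the masks that meet `u`; the disjoint ones are the complement.
  have hcompl : ∀ (u : ℕ) (Z : List ℕ), Z.length - (Z.map fun z => if u &&& z = 0 then 0 else 1).sum
      = (Z.map fun z => if u &&& z = 0 then 1 else 0).sum := by
    intro u Z
    suffices h : Z.length = (Z.map fun z => if u &&& z = 0 then 0 else 1).sum +
        (Z.map fun z => if u &&& z = 0 then 1 else 0).sum by omega
    induction Z with
    | nil => rfl
    | cons z Z ih =>
      simp only [List.length_cons, List.map_cons, List.sum_cons]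
      split_ifs <;> omega
  induction Y with
  | nil => rfl
  | cons y Y ih =>
    rw [List.map_cons, List.sum_cons, ← ih fun y hy => hY y (List.mem_cons_of_mem _ hy)]
    refine congrArg (· + packedPairs k Z.length (packOnes k Z) (packDigits k Z) x Y) ?_
    by_cases h : x &&& y = 0
    · simp only [h, true_and]
      rw [packedCount_eq (Nat.or_lt_two_pow hx (hY y List.mem_cons_self)) hZ hlen, hcompl]
      simp only [lor_land_eq_zero_iff]
      rfl
    · have hb : Nat.beq (x &&& y) 0 = false := by
        rw [← Bool.not_eq_true, Nat.beq_eq]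
        exact h
      simp [h, hb]

theorem packedTriples_eq {k : ℕ} {X Y Z : List ℕ} (hX : ∀ x ∈ X, x < 2 ^ k)
    (hY : ∀ y ∈ Y, y < 2 ^ k) (hZ : ∀ z ∈ Z, z < 2 ^ k) (hlen : Z.length < 2 ^ k) :
    packedTriples k Z.length (packOnes k Z) (packDigits k Z) Y X = disjointTriples X Y Z := by
  induction X with
  | nil => rfl
  | cons x X ih =>
    have ih := ih fun x hx => hX x (List.mem_cons_of_mem _ hx)
    rw [disjointTriples, List.map_cons, List.sum_cons,
      ← packedPairs_eq (hX x List.mem_cons_self) hY hZ hlen]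
    exact congrArg (packedPairs k Z.length (packOnes k Z) (packDigits k Z) x Y + ·) ih

/-- The exponent `m * m` would already bound the masks; the extra 1 keeps the list length below the
power of two when `m = 0`. -/
theorem lt_two_pow_of_mem_blockMasks {m a : ℕ} : ∀ x ∈ blockMasks m a, x < 2 ^ (m * m + 1) := by
  intro x hx
  obtain ⟨c, -, rfl⟩ := List.mem_map.1 hx
  exact (Nat.ofBits_lt_two_pow _).trans (Nat.pow_lt_pow_succ one_lt_two)

/-! ### Tables of triple counts -/

/-- Look up the entry for the multiset `{a, b, c}` in a table indexed by `a`, `b - a` and `c - b`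
for `a ≤ b ≤ c`. -/
def sortedLookup (L : List (List (List ℕ))) (a b c : ℕ) : ℕ :=
  let x := min a (min b c)
  let z := max a (max b c)
  let y := a + b + c - x - z
  ((L.getD x []).getD (y - x) []).getD (z - y) 0

/-- `L` lists the values of `disjointTriples` on the lists `blockMasks m a`. -/
noncomputable def checkTable (m : ℕ) (L : List (List (List ℕ))) : Bool :=
  (List.range (m + 1)).all fun c =>
    Nat.blt (blockMasks m c).length (2 ^ (m * m + 1)) &&
    (List.range (c + 1)).all fun b => (List.range (b + 1)).all fun a =>
      Nat.beq (packedTriples (m * m + 1) (blockMasks m c).length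
        (packOnes (m * m + 1) (blockMasks m c)) (packDigits (m * m + 1) (blockMasks m c))
        (blockMasks m b) (blockMasks m a))
        (((L.getD a []).getD (b - a) []).getD (c - b) 0)

theorem sortedLookup_swap_left (L : List (List (List ℕ))) (a b c : ℕ) :
    sortedLookup L a b c = sortedLookup L b a c := by
  simp only [sortedLookup, min_left_comm a b c, max_left_comm a b c, add_comm a b]

theorem sortedLookup_swap_right (L : List (List (List ℕ))) (a b c : ℕ) :
    sortedLookup L a b c = sortedLookup L a c b := by
  simp only [sortedLookup, min_comm b c, max_comm b c, add_right_comm a b c]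

/-- Both sides are symmetric in `a`, `b`, `c`, so adjacent swaps reduce to the sorted case that was
checked. -/
theorem disjointTriples_eq_sortedLookup {m : ℕ} {L : List (List (List ℕ))}
    (h : checkTable m L = true) {a b c : ℕ} (ha : a ≤ m) (hb : b ≤ m) (hc : c ≤ m) :
    disjointTriples (blockMasks m a) (blockMasks m b) (blockMasks m c) = sortedLookup L a b c := by
  have key : ∀ a b c, a ≤ b → b ≤ c → c ≤ m →
      disjointTriples (blockMasks m a) (blockMasks m b) (blockMasks m c) =
        sortedLookup L a b c := by
    intro a b c hab hbc hcm
    simp only [checkTable, List.all_eq_true, List.mem_range, Bool.and_eq_true, Nat.blt_eq] at h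
    obtain ⟨hlen, h⟩ := h c (by omega)
    have h := Nat.eq_of_beq_eq_true (h b (by omega) a (by omega))
    rw [packedTriples_eq lt_two_pow_of_mem_blockMasks lt_two_pow_of_mem_blockMasks
      lt_two_pow_of_mem_blockMasks hlen] at h
    rw [h, sortedLookup, min_eq_left hbc, min_eq_left hab, max_eq_right hbc,
      max_eq_right (hab.trans hbc)]
    rw [show a + b + c - a - c = b by omega]
  rcases le_total a b with hab | hab <;> rcases le_total b c with hbc | hbc <;>
    rcases le_total a c with hac | hac
  · exact key _ _ _ hab hbc hc
  · exact key _ _ _ hab hbc hc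
  · rw [disjointTriples_swap_right, sortedLookup_swap_right]
    exact key _ _ _ hac hbc hb
  · rw [disjointTriples_swap_right, sortedLookup_swap_right, disjointTriples_swap_left,
      sortedLookup_swap_left]
    exact key _ _ _ hac hab hb
  · rw [disjointTriples_swap_left, sortedLookup_swap_left]
    exact key _ _ _ hab hac hc
  · rw [disjointTriples_swap_left, sortedLookup_swap_left, disjointTriples_swap_right,
      sortedLookup_swap_right]
    exact key _ _ _ hbc hac ha
  · rw [disjointTriples_swap_left, sortedLookup_swap_left, disjointTriples_swap_right,
      sortedLookup_swap_right, disjointTriples_swap_left, sortedLookup_swap_left]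
    exact key _ _ _ hbc hab ha
  · rw [disjointTriples_swap_left, sortedLookup_swap_left, disjointTriples_swap_right,
      sortedLookup_swap_right, disjointTriples_swap_left, sortedLookup_swap_left]
    exact key _ _ _ hbc hab ha

theorem factorial_mul_ncard_eq_sum_sortedLookup {m : ℕ} {L : List (List (List ℕ))}
    (h : checkTable m L = true) (r s n : ℕ) :
    m.factorial * (partialLatinRectanglesOfSize r s n m).ncard =
      ∑ a ∈ Finset.range (m + 1), r.descFactorial a *
        ∑ b ∈ Finset.range (m + 1), s.descFactorial b *
          ∑ c ∈ Finset.range (m + 1), n.descFactorial c * sortedLookup L a b c := by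
  rw [factorial_mul_ncard_partialLatinRectanglesOfSize]
  refine Finset.sum_congr rfl fun a ha => congrArg _ <| Finset.sum_congr rfl fun b hb =>
    congrArg _ <| Finset.sum_congr rfl fun c hc => congrArg _ ?_
  have ha := Finset.mem_range_succ_iff.1 ha
  have hb := Finset.mem_range_succ_iff.1 hb
  have hc := Finset.mem_range_succ_iff.1 hc
  exact disjointTriples_eq_sortedLookup h ha hb hc

/-- For `k > n` the truncated difference is harmless because the falling factorial vanishes; hence
the polynomials are valid for small `n` too. -/
theorem cast_descFactorial_succ (n k : ℕ) :
    (n.descFactorial (k + 1) : ℤ) = (n - k) * n.descFactorial k := by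
  rw [Nat.descFactorial_succ, Nat.cast_mul]
  rcases le_or_gt k n with h | h
  · rw [Nat.cast_sub h]
  · simp [Nat.descFactorial_eq_zero_iff_lt.2 h]

/-- The numbers of triples of set partitions of an `0`-element set with pairwise trivial meets,
by numbers of blocks. -/
def table0 : List (List (List ℕ)) :=
  [[[1]]]

/-- Omitted table entries read as 0 and are checked as such. For instance, a one-block partition
forces the other two to be discrete, so the row `a = 1` of each later table holds only the triple
`(1, m, m)`. -/
theorem checkTable_table0 : checkTable 0 table0 = true := by
  decide +kernel

/-- The numbers of triples of set partitions of an `1`-element set with pairwise trivial meets,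
by numbers of blocks. -/
def table1 : List (List (List ℕ)) :=
  [[],
    [[1]]]

theorem checkTable_table1 : checkTable 1 table1 = true := by
  decide +kernel

/-- The numbers of triples of set partitions of an `2`-element set with pairwise trivial meets,
by numbers of blocks. -/
def table2 : List (List (List ℕ)) :=
  [[],
    [[], [1]],
    [[1]]]

theorem checkTable_table2 : checkTable 2 table2 = true := by
  decide +kernel

/-- The numbers of triples of set partitions of an `3`-element set with pairwise trivial meets,
by numbers of blocks. -/
def table3 : List (List (List ℕ)) :=
  [[],
    [[], [], [1]],
    [[6, 6], [3]],
    [[1]]]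

theorem checkTable_table3 : checkTable 3 table3 = true := by
  decide +kernel

/-- The numbers of triples of set partitions of an `4`-element set with pairwise trivial meets,
by numbers of blocks. -/
def table4 : List (List (List ℕ)) :=
  [[],
    [[], [], [], [1]],
    [[6, 12, 6], [60, 24], [7]],
    [[120, 30], [6]],
    [[1]]]

theorem checkTable_table4 : checkTable 4 table4 = true := by
  decide +kernel

/-- The numbers of triples of set partitions of an `5`-element set with pairwise trivial meets,
by numbers of blocks. -/
def table5 : List (List (List ℕ)) :=
  [[],
    [[], [], [], [], [1]],
    [[], [180, 240, 60], [360, 80], [15]],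
    [[1590, 1620, 300], [1260, 190], [25]],
    [[720, 90], [10]],
    [[1]]]

theorem checkTable_table5 : checkTable 5 table5 = true := by
  decide +kernel

/-- The numbers of triples of set partitions of an `6`-element set with pairwise trivial meets,
by numbers of blocks. -/
def table6 : List (List (List ℕ)) :=
  [[],
    [[], [], [], [], [], [1]],
    [[], [120, 540, 360, 60], [3240, 2340, 360], [1680, 240], [31]],
    [[7680, 21120, 11880, 1560], [47910, 23040, 2610], [9660, 975], [90]],
    [[76950, 29430, 2810], [9660, 825], [65]],
    [[2730, 210], [15]],
    [[1]]]

theorem checkTable_table6 : checkTable 6 table6 = true := by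
  decide +kernel

/-! ### Computable polynomial arithmetic -/

/-- The value at `x` of the polynomial with coefficients `p`, constant term first. -/
def evalCoeffs (x : ℤ) : List ℤ → ℤ
  | [] => 0
  | a :: p => a + x * evalCoeffs x p

/-- Addition of coefficient lists. -/
def addCoeffs : List ℤ → List ℤ → List ℤ
  | [], q => q
  | a :: p, [] => a :: p
  | a :: p, b :: q => (a + b) :: addCoeffs p q

/-- Multiplication of coefficient lists. -/
def mulCoeffs : List ℤ → List ℤ → List ℤ
  | [], _ => []
  | a :: p, q => addCoeffs (q.map (a * ·)) (0 :: mulCoeffs p q)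

/-- The sum of the first `k` coefficient lists of a sequence. -/
def sumCoeffs (P : ℕ → List ℤ) : ℕ → List ℤ
  | 0 => []
  | k + 1 => addCoeffs (sumCoeffs P k) (P k)

/-- The coefficients of the falling factorial `x (x - 1) ⋯ (x - k + 1)`. -/
def fallingCoeffs : ℕ → List ℤ
  | 0 => [1]
  | k + 1 => mulCoeffs [-k, 1] (fallingCoeffs k)

theorem evalCoeffs_add (x : ℤ) (p q : List ℤ) :
    evalCoeffs x (addCoeffs p q) = evalCoeffs x p + evalCoeffs x q := by
  induction p generalizing q with
  | nil => simp [addCoeffs, evalCoeffs]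
  | cons a p ih =>
    cases q with
    | nil => simp [addCoeffs, evalCoeffs]
    | cons b q =>
      simp only [addCoeffs, evalCoeffs, ih]
      ring

theorem evalCoeffs_map_mul (x a : ℤ) (p : List ℤ) :
    evalCoeffs x (p.map (a * ·)) = a * evalCoeffs x p := by
  induction p with
  | nil => simp [evalCoeffs]
  | cons b p ih =>
    simp only [List.map_cons, evalCoeffs, ih]
    ring

theorem evalCoeffs_mul (x : ℤ) (p q : List ℤ) :
    evalCoeffs x (mulCoeffs p q) = evalCoeffs x p * evalCoeffs x q := by
  induction p with
  | nil => simp [mulCoeffs, evalCoeffs]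
  | cons a p ih =>
    simp only [mulCoeffs, evalCoeffs_add, evalCoeffs_map_mul, evalCoeffs, ih]
    ring

theorem evalCoeffs_sum (x : ℤ) (P : ℕ → List ℤ) (k : ℕ) :
    evalCoeffs x (sumCoeffs P k) = ∑ i ∈ Finset.range k, evalCoeffs x (P i) := by
  induction k with
  | zero => simp [sumCoeffs, evalCoeffs]
  | succ k ih => rw [sumCoeffs, evalCoeffs_add, ih, Finset.sum_range_succ]

theorem evalCoeffs_falling (n k : ℕ) :
    evalCoeffs n (fallingCoeffs k) = (n.descFactorial k : ℤ) := by
  induction k with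
  | zero => simp [fallingCoeffs, evalCoeffs]
  | succ k ih =>
    rw [fallingCoeffs, evalCoeffs_mul, ih, cast_descFactorial_succ]
    simp only [evalCoeffs]
    ring

/-- The coefficients of the polynomial in `n` that counts the enumerated partial Latin squares of
size `m` and order `n`, if `L` is the table of the numbers of triples of set partitions. -/
def countingCoeffs (m : ℕ) (L : List (List (List ℕ))) : List ℤ :=
  sumCoeffs (fun a => mulCoeffs (fallingCoeffs a) <|
    sumCoeffs (fun b => mulCoeffs (fallingCoeffs b) <|
      sumCoeffs (fun c => (fallingCoeffs c).map ((sortedLookup L a b c : ℤ) * ·))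
        (m + 1)) (m + 1)) (m + 1)

theorem factorial_mul_ncard_eq_evalCoeffs {m : ℕ} {L : List (List (List ℕ))} {p : List ℤ}
    (h : checkTable m L = true) (hp : countingCoeffs m L = p) (n : ℕ) :
    (m.factorial : ℤ) * ((partialLatinRectanglesOfSize n n n m).ncard : ℤ) = evalCoeffs n p := by
  rw [← hp]
  simp only [countingCoeffs, evalCoeffs_sum, evalCoeffs_mul, evalCoeffs_falling, evalCoeffs_map_mul]
  have := congrArg (Nat.cast : ℕ → ℤ) (factorial_mul_ncard_eq_sum_sortedLookup h n n n)
  push_cast at this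
  simp only [mul_comm ((sortedLookup _ _ _ _ : ℕ) : ℤ)]
  exact this

theorem countingCoeffs_table0 : countingCoeffs 0 table0 =
    [1] := by
  decide +kernel

theorem countingCoeffs_table1 : countingCoeffs 1 table1 =
    [0, 0, 0, 1] := by
  decide +kernel

theorem countingCoeffs_table2 : countingCoeffs 2 table2 =
    [0, 0, 0, 2, -3, 0, 1] := by
  decide +kernel

theorem countingCoeffs_table3 : countingCoeffs 3 table3 =
    [0, 0, 0, 14, -36, 24, 6, -9, 0, 1] := by
  decide +kernel

theorem countingCoeffs_table4 : countingCoeffs 4 table4 =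
    [0, 0, 0, 198, -684, 810, -262, -180, 123, 12, -18, 0, 1] := by
  decide +kernel

theorem countingCoeffs_table5 : countingCoeffs 5 table5 =
    [0, 0, 0, 4512, -19080, 30960, -21650, 1992, 5610, -2170, -540, 375, 20, -30, 0, 1] := by
  decide +kernel

theorem countingCoeffs_table6 : countingCoeffs 6 table6 =
    [0, 0, 0, 146400, -722160, 1453680, -1461548, 635850, 89160, -196380, 42282, 22320, -9215,
      -1260, 885, 30, -45, 0, 1] := by
  decide +kernel

/-! ### The seven formulas -/

theorem mainTheorem8 (n : ℕ) (hn : 0 < n) :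
    ((partialLatinRectanglesOfSize n n n 0).ncard : ℤ) = 1 ∧
    ((partialLatinRectanglesOfSize n n n 1).ncard : ℤ) = (n : ℤ) ^ 3 ∧
    (Nat.factorial 2 : ℤ) * ((partialLatinRectanglesOfSize n n n 2).ncard : ℤ) =
      (n : ℤ) ^ 3 * ((n : ℤ) - 1) ^ 2 * ((n : ℤ) + 2) ∧
    (Nat.factorial 3 : ℤ) * ((partialLatinRectanglesOfSize n n n 3).ncard : ℤ) =
      (n : ℤ) ^ 3 * ((n : ℤ) - 1) ^ 2 *
        ((n : ℤ) ^ 4 + 2 * (n : ℤ) ^ 3 - 6 * (n : ℤ) ^ 2 - 8 * (n : ℤ) + 14) ∧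
    (Nat.factorial 4 : ℤ) * ((partialLatinRectanglesOfSize n n n 4).ncard : ℤ) =
      (n : ℤ) ^ 3 * ((n : ℤ) - 1) ^ 2 *
        ((n : ℤ) ^ 7 + 2 * (n : ℤ) ^ 6 - 15 * (n : ℤ) ^ 5 - 20 * (n : ℤ) ^ 4
          + 98 * (n : ℤ) ^ 3 + 36 * (n : ℤ) ^ 2 - 288 * (n : ℤ) + 198) ∧
    (Nat.factorial 5 : ℤ) * ((partialLatinRectanglesOfSize n n n 5).ncard : ℤ) =
      (n : ℤ) ^ 3 * ((n : ℤ) - 1) ^ 2 * ((n : ℤ) - 2) ^ 2 *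
        ((n : ℤ) ^ 8 + 6 * (n : ℤ) ^ 7 - 7 * (n : ℤ) ^ 6 - 88 * (n : ℤ) ^ 5
          + 6 * (n : ℤ) ^ 4 + 532 * (n : ℤ) ^ 3 - 84 * (n : ℤ) ^ 2 - 1386 * (n : ℤ) + 1128) ∧
    (Nat.factorial 6 : ℤ) * ((partialLatinRectanglesOfSize n n n 6).ncard : ℤ) =
      (n : ℤ) ^ 3 * ((n : ℤ) - 1) ^ 2 * ((n : ℤ) - 2) ^ 2 *
        ((n : ℤ) ^ 11 + 6 * (n : ℤ) ^ 10 - 22 * (n : ℤ) ^ 9 - 168 * (n : ℤ) ^ 8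
          + 231 * (n : ℤ) ^ 7 + 2022 * (n : ℤ) ^ 6 - 2014 * (n : ℤ) ^ 5
          - 12606 * (n : ℤ) ^ 4 + 16168 * (n : ℤ) ^ 3 + 32250 * (n : ℤ) ^ 2
          - 70740 * (n : ℤ) + 36600) := by
  refine ⟨?_, ?_, ?_, ?_, ?_, ?_, ?_⟩
  · simpa [evalCoeffs] using
      factorial_mul_ncard_eq_evalCoeffs checkTable_table0 countingCoeffs_table0 n
  · have h := factorial_mul_ncard_eq_evalCoeffs checkTable_table1 countingCoeffs_table1 n
    rw [Nat.factorial, Nat.factorial] at h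
    simpa [evalCoeffs, pow_succ', mul_assoc] using h
  · rw [factorial_mul_ncard_eq_evalCoeffs checkTable_table2 countingCoeffs_table2 n]
    simp only [evalCoeffs]
    ring
  · rw [factorial_mul_ncard_eq_evalCoeffs checkTable_table3 countingCoeffs_table3 n]
    simp only [evalCoeffs]
    ring
  · rw [factorial_mul_ncard_eq_evalCoeffs checkTable_table4 countingCoeffs_table4 n]
    simp only [evalCoeffs]
    ring
  · rw [factorial_mul_ncard_eq_evalCoeffs checkTable_table5 countingCoeffs_table5 n]
    simp only [evalCoeffs]
    ring
  · rw [factorial_mul_ncard_eq_evalCoeffs checkTable_table6 countingCoeffs_table6 n]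
    simp only [evalCoeffs]
    ring
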